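/- Let $k\ge 2$ be an integer. Put $c_k=1-\frac{3(2k-1)^2}{2k+1}$ and, for $1\le i\le k$, $h_{i,k}=\frac{(2(k-i)+1)^2-(2k-1)^2}{8(2k+1)}$. For $z$ in the upper half-plane $\mathbb{H}$ write $q^r=e^{2\pi i r z}$ for rational $r$, and let $$\mathrm{ch}_{i,k}=q^{\,h_{i,k}-c_k/24}\prod_{\substack{n\ge 1\\ n\not\equiv 0,\pm i\ (\mathrm{mod}\ 2k+1)}}\frac{1}{1-q^n}$$ (the character, in product form, of the irreducible lowest weight module of the Virasoro algebra of central charge $c_k$ and weight $h_{i,k}$). Let $f'=\frac{1}{2\pi i}\frac{df}{dz}$, so that $\left(\sum a(n)q^n\right)'=\sum n\,a(n)q^n$, and let $f^{(j)}$ be the $j$-th iterate. Then there is exactly one constant $\alpha(k)\in\mathbb{C}$ such that the $q$-expansion of $$\mathcal{W}_k=\alpha(k)\cdot\det\left(\mathrm{ch}_{i,k}^{(j)}\right)_{0\le j\le k-1,\ 1\le i\le k}$$ has leading coefficient $1$, and with this constant $$\mathcal{W}_k=\eta(z)^{2k(k-1)}\qquad\text{for all }z\in\mathbb{H},$$ where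 $\eta(z)=q^{1/24}\prod_{n=1}^\infty(1-q^n)$ is Dedekind's eta-function. -/

import Mathlib

open scoped UpperHalfPlane

noncomputable section

namespace AndrewsGordon

/-- The central charge `c_k = 1 - 3 (2k-1)² / (2k+1)`. -/
def centralCharge (k : ℕ) : ℚ := 1 - 3 * (2 * (k : ℚ) - 1) ^ 2 / (2 * (k : ℚ) + 1)

/-- The lowest weight `h_{i,k} = ((2(k-i)+1)² - (2k-1)²) / (8(2k+1))`. -/
def lowestWeight (i k : ℕ) : ℚ :=
  ((2 * ((k : ℚ) - (i : ℚ)) + 1) ^ 2 - (2 * (k : ℚ) - 1) ^ 2) / (8 * (2 * (k : ℚ) + 1))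

/-- For a rational number `r` and `z` in the upper half-plane, `q^r = e^{2πi r z}`. -/
def qPow (r : ℚ) (z : ℍ) : ℂ := Complex.exp (2 * (Real.pi : ℂ) * Complex.I * (r : ℂ) * (z : ℂ))

/-- The integers `n ≥ 1` with `n ≢ 0, ±i (mod 2k+1)`. -/
def parts (i k : ℕ) : Set ℕ :=
  {n | 1 ≤ n ∧ ¬ (n : ℤ) ≡ 0 [ZMOD (2 * k + 1)] ∧ ¬ (n : ℤ) ≡ i [ZMOD (2 * k + 1)] ∧
    ¬ (n : ℤ) ≡ -i [ZMOD (2 * k + 1)]}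

/-- The character `ch_{i,k}`, that is
`q^{h_{i,k} - c_k/24} ∏_{1 ≤ n ≢ 0, ±i (mod 2k+1)} 1 / (1 - q^n)` with `q = e^{2πiz}`. -/
def character (i k : ℕ) (z : ℍ) : ℂ :=
  qPow (lowestWeight i k - centralCharge k / 24) z *
    ∏' n : parts i k, 1 / (1 - qPow ((n : ℕ) : ℚ) z)

/-- The ordinary Wronskian `det (f_i^{(j)})`, `0 ≤ j < n`, for the differentiation
`f' = (2πi)⁻¹ df/dz = q df/dq`; the rows are indexed by the order of differentiation. -/
def wronskian {n : ℕ} (f : Fin n → ℍ → ℂ) (z : ℍ) : ℂ :=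
  Matrix.det (Matrix.of fun j i : Fin n =>
    (Derivative.normalizedDerivOfComplex^[(j : ℕ)] (f i)) z)

/-- `f` has a `q`-expansion `∑_{n ≥ 0} b(n) q^{r + n/N}`, with `r` rational and `N ≥ 1`,
convergent on the whole upper half-plane, whose leading coefficient `b(0)` is `c ≠ 0`. -/
def HasLeadingCoeff (f : ℍ → ℂ) (c : ℂ) : Prop :=
  c ≠ 0 ∧ ∃ (r : ℚ) (N : ℕ) (b : ℕ → ℂ), 0 < N ∧ b 0 = c ∧
    ∀ z : ℍ, HasSum (fun n : ℕ => b n * qPow (r + (n : ℚ) / (N : ℚ)) z) (f z)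

end AndrewsGordon

end

/-!
The quotient of the Wronskian by `η^{2k(k-1)}` is a modular function on the full modular group
without poles and with a finite nonzero limit at the cusp, hence a nonzero constant.

Modularity comes from theta functions. Grouping the factors `1 - q^n` by residues modulo `2k+1`, the
Jacobi triple product turns `η · ch_{i,k}` into a theta series of the lattice `√(2k+1) ℤ`
(`character_eq_theta_div_eta`). Poisson summation, available as the functional equation of
`jacobiTheta₂`, shows that the span of these theta series is preserved by `z ↦ -1/z` up to a factor
`√z`. The factor is cancelled by that of `η`, so the inversion maps each character to a linear
combination of characters (`exists_character_S_smul`). The triple product itself is the limit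
of a finite identity for `q²`-binomial coefficients (`tendsto_tripleProduct`).

Consequently the Wronskian `W` satisfies `W(-1/z) = det M · z^{k(k-1)} W(z)` with a constant matrix
`M`: by the chain rule `D^n (f ∘ S)` is a triangular combination of the `(D^m f) ∘ S`, with diagonal
coefficients `z^{-2n}` (`wronskian_comp_S_smul`). Near the cusp
`W = q^{∑ (h_{i,k} - c_k/24)} H(q)` with `H` holomorphic on the disc and `H(0)` the Vandermonde
determinant of the exponents, which are distinct; their sum is `k(k-1)/12`, the exponent of
`η^{2k(k-1)}` (`exists_wronskian_character_eq`). So `F = W / η^{2k(k-1)}` is a holomorphic function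
of `q` on the disc with `F(-1/z) = ε F(z)`. Here `ε² = 1`, so `F²` is a modular form of weight zero
and is constant; then `F(i) ≠ 0` forces `ε = 1`, and `F` is constant too
(`eq_const_of_quasi_invariant`).

The existence and uniqueness of the normalizing constant follow because the leading exponent and the
leading coefficient of a `q`-expansion can be read off from the growth as `Im z → ∞`
(`HasLeadingCoeff.eq_mul`).
-/

namespace AndrewsGordon

open Filter Topology
open scoped UpperHalfPlane Manifold Derivative

/-! ### The Jacobi triple product -/

/-- The finite `q`-Pochhammer symbol `(p; p)_n = ∏_{m=1}^n (1 - p^m)`. -/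
noncomputable def qFactorial (p : ℂ) (n : ℕ) : ℂ := ∏ m ∈ Finset.range n, (1 - p ^ (m + 1))

/-- `1 / (p; p)_m`, extended by `0` to negative `m`, so that the recurrence
`invQFactorial_sub_one` holds for all integers `m`. -/
noncomputable def invQFactorial (p : ℂ) (m : ℤ) : ℂ := if m < 0 then 0 else (qFactorial p m.toNat)⁻¹

lemma one_sub_pow_ne_zero {p : ℂ} (hp : ‖p‖ < 1) {m : ℕ} (hm : m ≠ 0) : 1 - p ^ m ≠ 0 := by
  intro h
  have h1 : ‖p ^ m‖ < 1 := by
    rw [norm_pow]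
    exact pow_lt_one₀ (norm_nonneg _) hp hm
  rw [← sub_eq_zero.mp h] at h1
  simp at h1

lemma tprod_one_sub_pow_ne_zero {p : ℂ} (hp : ‖p‖ < 1) : ∏' n : ℕ, (1 - p ^ (n + 1)) ≠ 0 := by
  have hs : Summable fun n : ℕ => ‖-p ^ (n + 1)‖ := by
    simpa using (summable_nat_add_iff 1).mpr (summable_geometric_of_lt_one (norm_nonneg _) hp)
  simpa [sub_eq_add_neg] using tprod_one_add_ne_zero_of_summable (f := fun n : ℕ => -p ^ (n + 1))
    (fun n => by simpa [sub_eq_add_neg] using one_sub_pow_ne_zero hp (Nat.succ_ne_zero n)) hs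

lemma qFactorial_ne_zero {p : ℂ} (hp : ‖p‖ < 1) (n : ℕ) : qFactorial p n ≠ 0 :=
  Finset.prod_ne_zero_iff.mpr fun _ _ => one_sub_pow_ne_zero hp (Nat.succ_ne_zero _)

lemma qFactorial_succ (p : ℂ) (n : ℕ) : qFactorial p (n + 1) = qFactorial p n * (1 - p ^ (n + 1)) :=
  Finset.prod_range_succ _ _

/-- Valid for every integer `m`: at `m = 0` the factor `1 - p^m` vanishes, which is what makes the
extension by zero consistent. -/
lemma invQFactorial_sub_one {p : ℂ} (hp : ‖p‖ < 1) (m : ℤ) :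
    invQFactorial p (m - 1) = (1 - p ^ m) * invQFactorial p m := by
  rcases lt_trichotomy m 0 with h | rfl | h
  · simp [invQFactorial, h, show m - 1 < 0 by lia]
  · simp [invQFactorial]
  · obtain ⟨n, rfl⟩ : ∃ n : ℕ, m = n + 1 := ⟨(m - 1).toNat, by lia⟩
    have h1 := qFactorial_ne_zero hp n
    have h2 := one_sub_pow_ne_zero hp (Nat.succ_ne_zero n)
    have h3 : ((n : ℤ) + 1).toNat = n + 1 := by lia
    simp only [invQFactorial, add_sub_cancel_right, show ¬ (n : ℤ) < 0 by lia, if_false,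
      show ¬ (n : ℤ) + 1 < 0 by lia, Int.toNat_natCast, h3, qFactorial_succ]
    rw [show (p ^ ((n : ℤ) + 1)) = p ^ (n + 1) by norm_cast]
    field_simp

/-- The finite form of the Jacobi triple product: a terminating sum with `q²`-binomial
coefficients. -/
lemma hasSum_finite_tripleProduct {q x : ℂ} (hq : ‖q‖ < 1) (hq0 : q ≠ 0) (hx : x ≠ 0) (n : ℕ) :
    HasSum (fun j : ℤ => qFactorial (q ^ 2) (2 * n) * invQFactorial (q ^ 2) (n - j) *
        invQFactorial (q ^ 2) (n + j) * (x ^ j * q ^ (j ^ 2)))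
      (∏ m ∈ Finset.range n, (1 + x * q ^ (2 * m + 1)) * (1 + x⁻¹ * q ^ (2 * m + 1))) := by
  have hp : ‖q ^ 2‖ < 1 := by
    rw [norm_pow]
    exact pow_lt_one₀ (norm_nonneg _) hq two_ne_zero
  induction n with
  | zero =>
    have h : ∀ j : ℤ, j ≠ 0 → qFactorial (q ^ 2) (2 * 0) * invQFactorial (q ^ 2) (((0 : ℕ) : ℤ) - j) *
        invQFactorial (q ^ 2) (((0 : ℕ) : ℤ) + j) * (x ^ j * q ^ (j ^ 2)) = 0 := by
      intro j hj
      rcases lt_or_gt_of_ne hj with h | h <;> simp [invQFactorial, h]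
    simpa [qFactorial, invQFactorial] using hasSum_single (0 : ℤ) h
  | succ n ih =>
    set F : ℤ → ℂ := fun j => qFactorial (q ^ 2) (2 * n) * invQFactorial (q ^ 2) (n - j) *
        invQFactorial (q ^ 2) (n + j) * (x ^ j * q ^ (j ^ 2)) with hF
    set Q : ℂ := q ^ (2 * n + 1) with hQ
    have hm : HasSum (F ∘ Equiv.subRight (1 : ℤ)) _ := (Equiv.subRight (1 : ℤ)).hasSum_iff.mpr ih
    have hpl : HasSum (F ∘ Equiv.addRight (1 : ℤ)) _ := (Equiv.addRight (1 : ℤ)).hasSum_iff.mpr ih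
    -- The new factor is `(1 + xQ)(1 + x⁻¹Q) = (1 + Q²) + xQ + x⁻¹Q`; the last two terms shift `j`.
    have key := ((ih.mul_left (1 + Q ^ 2)).add (hm.mul_left (x * Q))).add (hpl.mul_left (x⁻¹ * Q))
    rw [Finset.prod_range_succ]
    convert! key using 1
    · ext j
      have e1 := invQFactorial_sub_one hp ((n : ℤ) + 1 - j)
      have e2 := invQFactorial_sub_one hp ((n : ℤ) + 1 + j)
      have e3 := invQFactorial_sub_one hp ((n : ℤ) + 1 - j - 1)
      have e4 := invQFactorial_sub_one hp ((n : ℤ) + 1 + j - 1)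
      rw [e1] at e3
      rw [e2] at e4
      have hp0 : q ^ 2 ≠ 0 := pow_ne_zero 2 hq0
      have hab : ((q ^ 2) ^ ((n : ℤ) + 1 - j)) * ((q ^ 2) ^ ((n : ℤ) + 1 + j)) =
          (q ^ 2) ^ (2 * n + 2) := by
        rw [← zpow_add₀ hp0, ← zpow_natCast (q ^ 2) (2 * n + 2)]
        congr 1
        push_cast
        ring
      have hQa : x * Q * (x ^ (j - 1) * q ^ ((j - 1) ^ 2)) =
          (q ^ 2) ^ ((n : ℤ) + 1 - j) * (x ^ j * q ^ (j ^ 2)) := by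
        rw [hQ, zpow_sub_one₀ hx, ← zpow_natCast q (2 * n + 1), ← zpow_natCast q 2, ← zpow_mul]
        have : q ^ ((2 * n + 1 : ℕ) : ℤ) * q ^ ((j - 1) ^ 2) =
            q ^ (((2 : ℕ) : ℤ) * ((n : ℤ) + 1 - j)) * q ^ (j ^ 2) := by
          rw [← zpow_add₀ hq0, ← zpow_add₀ hq0]
          congr 1
          push_cast
          ring
        field_simp
        linear_combination this
      have hQb : x⁻¹ * Q * (x ^ (j + 1) * q ^ ((j + 1) ^ 2)) =
          (q ^ 2) ^ ((n : ℤ) + 1 + j) * (x ^ j * q ^ (j ^ 2)) := by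
        rw [hQ, zpow_add_one₀ hx, ← zpow_natCast q (2 * n + 1), ← zpow_natCast q 2, ← zpow_mul]
        have : q ^ ((2 * n + 1 : ℕ) : ℤ) * q ^ ((j + 1) ^ 2) =
            q ^ (((2 : ℕ) : ℤ) * ((n : ℤ) + 1 + j)) * q ^ (j ^ 2) := by
          rw [← zpow_add₀ hq0, ← zpow_add₀ hq0]
          congr 1
          push_cast
          ring
        field_simp
        linear_combination this
      have hQ2 : Q ^ 2 = (q ^ 2) ^ (2 * n + 1) := by
        rw [hQ]
        ring
      rw [zpow_sub_one₀ hp0] at e3 e4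
      simp only [hF, Function.comp_apply, Equiv.subRight_apply, Equiv.coe_addRight]
      rw [show 2 * (n + 1) = 2 * n + 1 + 1 by ring, qFactorial_succ, qFactorial_succ,
        show 2 * n + 1 + 1 = 2 * n + 2 by ring,
        show ((n + 1 : ℕ) : ℤ) - j = (n : ℤ) + 1 - j by push_cast; ring,
        show ((n + 1 : ℕ) : ℤ) + j = (n : ℤ) + 1 + j by push_cast; ring,
        show (n : ℤ) - (j - 1) = (n : ℤ) + 1 - j by ring,
        show (n : ℤ) + (j + 1) = (n : ℤ) + 1 + j by ring,
        show (n : ℤ) - (j + 1) = (n : ℤ) + 1 - j - 1 - 1 by ring,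
        show (n : ℤ) + (j - 1) = (n : ℤ) + 1 + j - 1 - 1 by ring,
        show (n : ℤ) - j = (n : ℤ) + 1 - j - 1 by ring,
        show (n : ℤ) + j = (n : ℤ) + 1 + j - 1 by ring, e1, e2, e3, e4, hQ2]
      -- With `p = q²`, `a = p^(n+1-j)` and `b = p^(n+1+j)` the claim is the polynomial identity
      -- `(1 - ab/p)(1 - ab) = (1 + ab/p)(1-a)(1-b) + a(1-b)(1-b/p) + b(1-a)(1-a/p)`.
      set a := (q ^ 2) ^ ((n : ℤ) + 1 - j)
      set b := (q ^ 2) ^ ((n : ℤ) + 1 + j)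
      set A := invQFactorial (q ^ 2) ((n : ℤ) + 1 - j)
      set B := invQFactorial (q ^ 2) ((n : ℤ) + 1 + j)
      have hab' : (q ^ 2) ^ (2 * n + 1) = a * b * (q ^ 2)⁻¹ := by
        rw [hab, show 2 * n + 2 = 2 * n + 1 + 1 by ring, pow_succ (q ^ 2) (2 * n + 1), mul_assoc,
          mul_inv_cancel₀ hp0, mul_one]
      rw [hab', ← hab]
      linear_combination (-qFactorial (q ^ 2) (2 * n) * A * B * (1 - b) * (1 - b * (q ^ 2)⁻¹)) * hQa
        - (qFactorial (q ^ 2) (2 * n) * A * B * (1 - a) * (1 - a * (q ^ 2)⁻¹)) * hQb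
    · field_simp
      ring

/-- The Jacobi triple product identity, with `q = e^{πiτ}` and `x = e^{2πiw}`, stated for the
partial products. -/
theorem tendsto_tripleProduct (w : ℂ) {τ : ℂ} (hτ : 0 < τ.im) :
    Tendsto (fun n : ℕ => ∏ m ∈ Finset.range n,
        ((1 + Complex.exp (2 * Real.pi * Complex.I * w) *
            Complex.exp (Real.pi * Complex.I * τ) ^ (2 * m + 1)) *
          (1 + (Complex.exp (2 * Real.pi * Complex.I * w))⁻¹ *
            Complex.exp (Real.pi * Complex.I * τ) ^ (2 * m + 1)) *
          (1 - (Complex.exp (Real.pi * Complex.I * τ) ^ 2) ^ (m + 1)))) atTop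
      (𝓝 (jacobiTheta₂ w τ)) := by
  set x := Complex.exp (2 * Real.pi * Complex.I * w) with hx
  set q := Complex.exp (Real.pi * Complex.I * τ) with hq
  have hq1 : ‖q‖ < 1 := by
    rw [hq, Complex.norm_exp]
    simp only [Complex.mul_re, Complex.ofReal_re, Complex.I_re, mul_zero, Complex.ofReal_im,
      Complex.I_im, mul_one, sub_self, zero_mul, Complex.mul_im, add_zero, zero_sub,
      Real.exp_lt_one_iff, Left.neg_neg_iff]
    positivity
  have hp : ‖q ^ 2‖ < 1 := by
    rw [norm_pow]
    exact pow_lt_one₀ (norm_nonneg _) hq1 two_ne_zero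
  have hterm (j : ℤ) : x ^ j * q ^ (j ^ 2) = jacobiTheta₂_term j w τ := by
    rw [hx, hq, ← Complex.exp_int_mul, ← Complex.exp_int_mul, ← Complex.exp_add, jacobiTheta₂_term]
    congr 1
    push_cast
    ring
  obtain ⟨L, hL0, hL⟩ : ∃ L : ℂ, L ≠ 0 ∧ Tendsto (qFactorial (q ^ 2)) atTop (𝓝 L) := by
    refine ⟨_, ?_, (ModularForm.multipliable_one_sub_pow hp).tendsto_prod_tprod_nat⟩
    exact tprod_one_sub_pow_ne_zero hp
  have hinv (m : ℕ → ℤ) (hm : Tendsto m atTop atTop) :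
      Tendsto (fun n => invQFactorial (q ^ 2) (m n)) atTop (𝓝 L⁻¹) := by
    have h1 : Tendsto (fun n => (m n).toNat) atTop atTop :=
      tendsto_atTop.mpr fun b => by
        filter_upwards [hm.eventually_ge_atTop (b : ℤ)] with n hn
        lia
    refine ((hL.comp h1).inv₀ hL0).congr' ?_
    filter_upwards [hm.eventually_ge_atTop 0] with n hn
    simp [invQFactorial, not_lt.mpr hn]
  obtain ⟨C, hC⟩ : ∃ C : ℝ, ∀ n, ‖qFactorial (q ^ 2) n‖ ≤ C := by
    obtain ⟨C, hC⟩ := (Metric.isBounded_range_of_tendsto _ hL).exists_norm_le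
    exact ⟨C, fun n => hC _ ⟨n, rfl⟩⟩
  obtain ⟨C', hC'⟩ : ∃ C : ℝ, ∀ m, ‖invQFactorial (q ^ 2) m‖ ≤ C := by
    obtain ⟨C, hC⟩ := (Metric.isBounded_range_of_tendsto _ (hL.inv₀ hL0)).exists_norm_le
    have hC0 : 0 ≤ C := (norm_nonneg _).trans (hC _ ⟨0, rfl⟩)
    refine ⟨C, fun m => ?_⟩
    unfold invQFactorial
    split_ifs
    · simpa using hC0
    · exact hC _ ⟨m.toNat, rfl⟩
  have hC0 : 0 ≤ C := (norm_nonneg _).trans (hC 0)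
  have hC0' : 0 ≤ C' := (norm_nonneg _).trans (hC' 0)
  -- Tannery's theorem: in the finite identity let the binomial coefficients tend to `1 / L`.
  have hlim : Tendsto (fun n : ℕ => ∏ m ∈ Finset.range n,
      (1 + x * q ^ (2 * m + 1)) * (1 + x⁻¹ * q ^ (2 * m + 1))) atTop
      (𝓝 (∑' j : ℤ, L⁻¹ * jacobiTheta₂_term j w τ)) := by
    have hfin (n : ℕ) := (hasSum_finite_tripleProduct hq1 (Complex.exp_ne_zero _)
      (Complex.exp_ne_zero (2 * Real.pi * Complex.I * w)) n).tsum_eq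
    simp_rw [← hx] at hfin
    simp_rw [← hfin, hterm]
    refine tendsto_tsum_of_dominated_convergence
      (bound := fun j => C * C' * C' * ‖jacobiTheta₂_term j w τ‖) ?_ ?_ ?_
    · exact (((summable_jacobiTheta₂_term_iff w τ).mpr hτ).norm).mul_left _
    · intro j
      refine Tendsto.mul_const _ ?_
      have h1 := hinv (fun n => (n : ℤ) - j)
        (tendsto_atTop_add_const_right _ (-j) tendsto_natCast_atTop_atTop)
      have h2 := hinv (fun n => (n : ℤ) + j)
        (tendsto_atTop_add_const_right _ j tendsto_natCast_atTop_atTop)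
      have h3 : Tendsto (fun n => qFactorial (q ^ 2) (2 * n)) atTop (𝓝 L) :=
        hL.comp (tendsto_id.const_mul_atTop' two_pos)
      have := (h3.mul h1).mul h2
      rwa [mul_inv_cancel₀ hL0, one_mul] at this
    · refine Eventually.of_forall fun n j => ?_
      rw [norm_mul, norm_mul, norm_mul]
      gcongr <;> grind
  have := hlim.mul hL
  rw [tsum_mul_left, mul_comm, ← mul_assoc, mul_inv_cancel₀ hL0, one_mul] at this
  refine this.congr fun n => ?_
  rw [qFactorial, ← Finset.prod_mul_distrib]

/-! ### Partial Euler products on the unit disc -/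

/-- The Euler product `∏_{n ∈ S} (1 - q^n)` as a function of `q`. It is written as a product over
all of `ℕ`, with factors `1` outside `S`, in the shape `1 + f n` used by Mathlib's convergence
criteria. -/
noncomputable def partialEuler (S : Set ℕ) (q : ℂ) : ℂ :=
  ∏' n : ℕ, (1 + -S.indicator (fun n => q ^ n) n)

lemma norm_neg_indicator_pow_le (S : Set ℕ) (q : ℂ) (n : ℕ) :
    ‖-S.indicator (fun n => q ^ n) n‖ ≤ ‖q‖ ^ n := by
  rw [norm_neg, ← norm_pow]
  exact norm_indicator_le_norm_self (fun n => q ^ n) n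

lemma summable_norm_neg_indicator_pow (S : Set ℕ) {q : ℂ} (hq : ‖q‖ < 1) :
    Summable fun n => ‖-S.indicator (fun n => q ^ n) n‖ :=
  .of_nonneg_of_le (fun _ => norm_nonneg _) (norm_neg_indicator_pow_le S q)
    (summable_geometric_of_lt_one (norm_nonneg _) hq)

lemma multipliable_partialEuler (S : Set ℕ) {q : ℂ} (hq : ‖q‖ < 1) :
    Multipliable fun n => 1 + -S.indicator (fun n => q ^ n) n :=
  multipliable_one_add_of_summable (summable_norm_neg_indicator_pow S hq)

lemma partialEuler_ne_zero {S : Set ℕ} (hS : 0 ∉ S) {q : ℂ} (hq : ‖q‖ < 1) :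
    partialEuler S q ≠ 0 := by
  refine tprod_one_add_ne_zero_of_summable (fun n => ?_) (summable_norm_neg_indicator_pow S hq)
  by_cases hn : n ∈ S
  · rw [Set.indicator_of_mem hn, ← sub_eq_add_neg]
    exact one_sub_pow_ne_zero hq (by rintro rfl; exact hS hn)
  · simp [hn]

lemma partialEuler_zero {S : Set ℕ} (hS : 0 ∉ S) : partialEuler S 0 = 1 := by
  unfold partialEuler
  convert! tprod_one with n
  by_cases hn : n ∈ S
  · have : n ≠ 0 := by rintro rfl; exact hS hn
    simp [this]
  · simp [hn]

lemma differentiableOn_partialEuler (S : Set ℕ) :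
    DifferentiableOn ℂ (partialEuler S) (Metric.ball 0 1) := by
  have h : HasProdLocallyUniformlyOn (fun n q => 1 + -S.indicator (fun n => q ^ n) n)
      (partialEuler S) (Metric.ball (0 : ℂ) 1) := by
    apply hasProdLocallyUniformlyOn_of_forall_compact Metric.isOpen_ball
    intro K hK hcK
    rcases K.eq_empty_or_nonempty with hN | hN
    · simpa [hasProdUniformlyOn_iff_tendstoUniformlyOn, hN] using! tendstoUniformlyOn_empty
    · obtain ⟨q₀, hq₀, _, HB⟩ := hcK.exists_sSup_image_eq_and_ge hN
        (show ContinuousOn (fun q : ℂ ↦ ‖q‖) K by fun_prop)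
      refine (summable_geometric_of_lt_one (norm_nonneg _)
        (by simpa [Metric.mem_ball, dist_zero_right] using hK hq₀)).hasProdUniformlyOn_nat_one_add
        hcK (.of_forall fun n x hx ↦ ?_) (fun n ↦ ?_)
      · exact (norm_neg_indicator_pow_le S x n).trans
          (pow_le_pow_left₀ (norm_nonneg _) (HB x hx) n)
      · by_cases hn : n ∈ S
        · simp only [Set.indicator_of_mem hn]
          fun_prop
        · simp only [Set.indicator_of_notMem hn]
          fun_prop
  refine h.differentiableOn (.of_forall fun s => ?_) Metric.isOpen_ball
  have : DifferentiableOn ℂ (fun q : ℂ => ∏ n ∈ s, (1 + -S.indicator (fun n => q ^ n) n))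
      (Metric.ball 0 1) := by
    refine DifferentiableOn.fun_finsetProd fun n _ => ?_
    by_cases hn : n ∈ S
    · simp only [Set.indicator_of_mem hn]
      fun_prop
    · simp only [Set.indicator_of_notMem hn]
      fun_prop
  exact this

lemma tprod_one_div_one_sub_pow {S : Set ℕ} (hS : 0 ∉ S) {q : ℂ} (hq : ‖q‖ < 1) :
    ∏' n : S, 1 / (1 - q ^ (n : ℕ)) = (partialEuler S q)⁻¹ := by
  rw [tprod_subtype S (fun n => 1 / (1 - q ^ n)), partialEuler,
    ← (multipliable_partialEuler S hq).tprod_inv₀ (partialEuler_ne_zero hS hq)]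
  refine tprod_congr fun n => ?_
  by_cases hn : n ∈ S
  · simp [hn, sub_eq_add_neg]
  · simp [hn]

/-! ### The characters as theta quotients -/

lemma qPow_natCast (n : ℕ) (z : ℍ) :
    qPow (n : ℚ) z = Complex.exp (2 * Real.pi * Complex.I * z) ^ n := by
  rw [qPow, ← Complex.exp_nat_mul]
  congr 1
  push_cast
  ring

lemma norm_exp_lt_one (z : ℍ) : ‖Complex.exp (2 * Real.pi * Complex.I * z)‖ < 1 :=
  UpperHalfPlane.norm_exp_two_pi_I_lt_one z

lemma zero_notMem_parts (i k : ℕ) : 0 ∉ parts i k := fun h => by simpa using h.1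

lemma character_eq (i k : ℕ) (z : ℍ) : character i k z =
    qPow (lowestWeight i k - centralCharge k / 24) z *
      (partialEuler (parts i k) (Complex.exp (2 * Real.pi * Complex.I * z)))⁻¹ := by
  rw [character, ← tprod_one_div_one_sub_pow (zero_notMem_parts i k) (norm_exp_lt_one z)]
  simp_rw [qPow_natCast]

/-- Natural-number form of the condition `n ≢ 0, ±i`; here `n ≥ 1` is automatic, as `0` has
residue `0`. -/
lemma mem_parts_iff {i k n : ℕ} (hi : 1 ≤ i) (hik : i ≤ k) :
    n ∈ parts i k ↔ n % (2 * k + 1) ≠ 0 ∧ n % (2 * k + 1) ≠ i ∧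
      n % (2 * k + 1) ≠ 2 * k + 1 - i := by
  have e0 : ((n : ℤ) ≡ 0 [ZMOD (2 * k + 1)]) ↔ n % (2 * k + 1) = 0 := by
    rw [Int.modEq_zero_iff_dvd, ← Nat.dvd_iff_mod_eq_zero]
    norm_cast
  have e1 : ((n : ℤ) ≡ i [ZMOD (2 * k + 1)]) ↔ n % (2 * k + 1) = i := by
    have : ((n : ℤ) ≡ i [ZMOD ((2 * k + 1 : ℕ) : ℤ)]) ↔ n ≡ i [MOD 2 * k + 1] :=
      Int.natCast_modEq_iff
    rw [Nat.ModEq, Nat.mod_eq_of_lt (show i < 2 * k + 1 by lia)] at this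
    exact_mod_cast this
  have e2 : ((n : ℤ) ≡ -i [ZMOD (2 * k + 1)]) ↔ n % (2 * k + 1) = 2 * k + 1 - i := by
    have h1 : ((n : ℤ) ≡ -i [ZMOD (2 * k + 1)]) ↔
        ((n : ℤ) ≡ ((2 * k + 1 - i : ℕ) : ℤ) [ZMOD ((2 * k + 1 : ℕ) : ℤ)]) := by
      have : ((2 * k + 1 - i : ℕ) : ℤ) = -i + (2 * k + 1) := by lia
      rw [this]
      push_cast
      exact ⟨fun h => h.trans (by simp [Int.ModEq]), fun h => h.trans (by simp [Int.ModEq])⟩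
    rw [h1, Int.natCast_modEq_iff, Nat.ModEq,
      Nat.mod_eq_of_lt (show 2 * k + 1 - i < 2 * k + 1 by lia)]
  simp only [parts, Set.mem_ofPred_eq, e0, e1, e2, ← ne_eq]
  constructor
  · exact fun h => h.2
  · refine fun h => ⟨?_, h⟩
    rcases Nat.eq_zero_or_pos n with rfl | hn
    · simp at h
    · exact hn

/-- Grouping the factors `1 - q^ℓ`, `1 ≤ ℓ ≤ (2k+1)n`, by the residue of `ℓ` modulo `2k+1`. -/
lemma prod_one_sub_pow_eq {i k : ℕ} (hi : 1 ≤ i) (hik : i ≤ k) (q : ℂ) (n : ℕ) :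
    ∏ l ∈ Finset.range ((2 * k + 1) * n), (1 - q ^ (l + 1)) =
      (∏ l ∈ Finset.range ((2 * k + 1) * n),
        (1 + -(parts i k).indicator (fun n => q ^ n) (l + 1))) *
      ∏ m ∈ Finset.range n, ((1 - q ^ ((2 * k + 1) * m + (2 * k + 1 - i))) *
        (1 - q ^ ((2 * k + 1) * m + i)) * (1 - q ^ ((2 * k + 1) * (m + 1)))) := by
  induction n with
  | zero => simp
  | succ n ih =>
    rw [Nat.mul_succ, Finset.prod_range_add _ _ (2 * k + 1), Finset.prod_range_add _ _ (2 * k + 1),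
      Finset.prod_range_succ _ n, ih]
    have hblock : ∏ x ∈ Finset.range (2 * k + 1), (1 - q ^ ((2 * k + 1) * n + x + 1)) =
        (∏ x ∈ Finset.range (2 * k + 1),
          (1 + -(parts i k).indicator (fun n => q ^ n) ((2 * k + 1) * n + x + 1))) *
        ((1 - q ^ ((2 * k + 1) * n + (2 * k + 1 - i))) *
        (1 - q ^ ((2 * k + 1) * n + i)) * (1 - q ^ ((2 * k + 1) * (n + 1)))) := by
      set f : ℕ → ℂ := fun x => 1 - q ^ ((2 * k + 1) * n + x + 1) with hf
      have h1 (x : ℕ) (hx : x ∈ Finset.range (2 * k + 1)) : f x =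
          (1 + -(parts i k).indicator (fun n => q ^ n) ((2 * k + 1) * n + x + 1)) *
          (((if x = 2 * k + 1 - i - 1 then f x else 1) * (if x = i - 1 then f x else 1)) *
            (if x = 2 * k then f x else 1)) := by
        rw [Finset.mem_range] at hx
        have hmod : ((2 * k + 1) * n + x + 1) % (2 * k + 1) = (x + 1) % (2 * k + 1) := by
          rw [add_assoc, Nat.mul_add_mod]
        have hmem := mem_parts_iff (n := (2 * k + 1) * n + x + 1) hi hik
        rw [hmod] at hmem
        rcases eq_or_ne x (2 * k) with rfl | h3
        · rw [Set.indicator_of_notMem (by rw [hmem]; simp), if_neg (by lia), if_neg (by lia),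
            if_pos rfl]
          ring
        rw [Nat.mod_eq_of_lt (by lia)] at hmem
        rw [if_neg h3]
        rcases eq_or_ne x (i - 1) with h2 | h2
        · rw [Set.indicator_of_notMem (by rw [hmem]; lia), if_neg (by lia), if_pos h2]
          ring
        rw [if_neg h2]
        rcases eq_or_ne x (2 * k + 1 - i - 1) with h4 | h4
        · rw [Set.indicator_of_notMem (by rw [hmem]; lia), if_pos h4]
          ring
        · rw [Set.indicator_of_mem (by rw [hmem]; lia), if_neg h4]
          simp only [hf]
          ring
      rw [Finset.prod_congr rfl h1, Finset.prod_mul_distrib, Finset.prod_mul_distrib,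
        Finset.prod_mul_distrib, Finset.prod_ite_eq', Finset.prod_ite_eq', Finset.prod_ite_eq',
        if_pos (by rw [Finset.mem_range]; lia), if_pos (by rw [Finset.mem_range]; lia),
        if_pos (by rw [Finset.mem_range]; lia)]
      simp only [hf]
      rw [show (2 * k + 1) * n + (2 * k + 1 - i - 1) + 1 = (2 * k + 1) * n + (2 * k + 1 - i) by lia,
        show (2 * k + 1) * n + (i - 1) + 1 = (2 * k + 1) * n + i by lia,
        show (2 * k + 1) * n + 2 * k + 1 = (2 * k + 1) * (n + 1) by ring]
    rw [hblock]
    ring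

/-- The theta function `∑_n (-1)^n q^{N (n + a/(2N))² / 2}`, `n ∈ ℤ`, in terms of the two-variable
Jacobi theta function: completing the square splits off `q^{a²/(8N)}`, and the shift by `1/2` in the
first argument produces the signs. -/
noncomputable def theta (N : ℕ) (a : ℤ) (z : ℂ) : ℂ :=
  Complex.exp (Real.pi * Complex.I * a ^ 2 * z / (4 * N)) *
    jacobiTheta₂ (1 / 2 + a * z / 2) (N * z)

/-- By the Jacobi triple product, `∏_{n ∈ parts i k} (1 - q^n)⁻¹` is a theta function divided by
Euler's product. -/
lemma jacobiTheta₂_eq_partialEuler {i k : ℕ} (hi : 1 ≤ i) (hik : i ≤ k) (z : ℍ) :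
    jacobiTheta₂ (1 / 2 + ((2 * k + 1 - 2 * i : ℤ) : ℂ) * z / 2) ((2 * k + 1 : ℕ) * z) =
      (∏' n : ℕ, (1 - Complex.exp (2 * Real.pi * Complex.I * z) ^ (n + 1))) *
        (partialEuler (parts i k) (Complex.exp (2 * Real.pi * Complex.I * z)))⁻¹ := by
  set q := Complex.exp (2 * Real.pi * Complex.I * z) with hqdef
  have hq : ‖q‖ < 1 := norm_exp_lt_one z
  have hτ : 0 < (((2 * k + 1 : ℕ) : ℂ) * (z : ℂ)).im := by
    rw [← Complex.ofReal_natCast, Complex.im_ofReal_mul]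
    have := z.im_pos
    have h2 : (0 : ℝ) < ((2 * k + 1 : ℕ) : ℝ) := by positivity
    exact mul_pos h2 this
  refine tendsto_nhds_unique (tendsto_tripleProduct _ hτ) ?_
  have hsub : Tendsto (fun n : ℕ => (2 * k + 1) * n) atTop atTop :=
    tendsto_id.const_mul_atTop' (by lia)
  have h1 := (ModularForm.multipliable_one_sub_pow hq).tendsto_prod_tprod_nat.comp hsub
  have h2 : Tendsto (fun n => ∏ l ∈ Finset.range n,
      (1 + -(parts i k).indicator (fun n => q ^ n) (l + 1))) atTop
      (𝓝 (partialEuler (parts i k) q)) := by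
    have := ((multipliable_partialEuler (parts i k) hq).tendsto_prod_tprod_nat).comp
      (tendsto_add_atTop_nat 1)
    refine this.congr fun n => ?_
    simp [Finset.prod_range_succ', zero_notMem_parts]
  have hne := partialEuler_ne_zero (zero_notMem_parts i k) hq
  refine (h1.mul ((h2.comp hsub).inv₀ hne)).congr fun n => ?_
  simp only [Function.comp_apply]
  have hRne : ∏ l ∈ Finset.range ((2 * k + 1) * n),
      (1 + -(parts i k).indicator (fun n => q ^ n) (l + 1)) ≠ 0 := by
    refine Finset.prod_ne_zero_iff.mpr fun l _ => ?_
    by_cases hl : l + 1 ∈ parts i k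
    · rw [Set.indicator_of_mem hl, ← sub_eq_add_neg]
      exact one_sub_pow_ne_zero hq (Nat.succ_ne_zero _)
    · simp [hl]
  rw [prod_one_sub_pow_eq hi hik, mul_comm, ← mul_assoc, inv_mul_cancel₀ hRne, one_mul]
  refine Finset.prod_congr rfl fun m _ => ?_
  have hpi : Complex.exp (Real.pi * Complex.I) = -1 := Complex.exp_pi_mul_I
  have hpi' : Complex.exp (-(Real.pi * Complex.I)) = -1 := by rw [Complex.exp_neg, hpi]; norm_num
  congr 1
  · congr 1
    · rw [sub_eq_add_neg, hqdef, ← Complex.exp_nat_mul, ← Complex.exp_nat_mul, ← Complex.exp_add,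
        ← neg_one_mul, ← hpi, ← Complex.exp_add]
      congr 2
      push_cast [show i ≤ 2 * k + 1 by lia]
      ring
    · rw [sub_eq_add_neg, hqdef, ← Complex.exp_nat_mul, ← Complex.exp_nat_mul, ← neg_one_mul,
        ← hpi', ← Complex.exp_neg, ← Complex.exp_add, ← Complex.exp_add]
      congr 2
      push_cast
      ring
  · rw [hqdef, ← Complex.exp_nat_mul, ← Complex.exp_nat_mul, ← Complex.exp_nat_mul]
    congr 2
    push_cast
    ring

/-- The exponent of `ch_{i,k}` times `η` is the leading exponent of the theta function. -/
lemma lowestWeight_sub (i k : ℕ) : lowestWeight i k - centralCharge k / 24 + 1 / 24 =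
    (2 * k + 1 - 2 * i) ^ 2 / (8 * (2 * k + 1)) := by
  unfold lowestWeight centralCharge
  have : (2 * (k : ℚ) + 1) ≠ 0 := by positivity
  field_simp
  ring

/-- The character is a theta function divided by `η`. -/
theorem character_eq_theta_div_eta {i k : ℕ} (hi : 1 ≤ i) (hik : i ≤ k) (z : ℍ) :
    character i k z = theta (2 * k + 1) (2 * k + 1 - 2 * i) z / ModularForm.eta z := by
  rw [eq_div_iff (ModularForm.eta_ne_zero z.2), character_eq, theta,
    jacobiTheta₂_eq_partialEuler hi hik, ModularForm.eta]
  simp only [ModularForm.eta_q_eq_pow]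
  have : qPow (lowestWeight i k - centralCharge k / 24) z * Function.Periodic.qParam 24 z =
      Complex.exp (Real.pi * Complex.I * ((2 * k + 1 - 2 * i : ℤ) : ℂ) ^ 2 * z /
        (4 * (2 * k + 1 : ℕ))) := by
    have h := congrArg (Rat.cast : ℚ → ℂ) (lowestWeight_sub i k)
    push_cast at h
    rw [qPow, Function.Periodic.qParam, ← Complex.exp_add]
    congr 1
    push_cast
    have h2 : (2 * (k : ℂ) + 1) ≠ 0 := by norm_cast
    have : Real.pi * Complex.I * (2 * (k : ℂ) + 1 - 2 * i) ^ 2 * z / (4 * (2 * k + 1)) =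
      2 * Real.pi * Complex.I * z * ((2 * k + 1 - 2 * i) ^ 2 / (8 * (2 * k + 1))) := by
      field_simp
      ring
    rw [this, ← h]
    ring
  rw [← this]
  ring

/-! ### The inversion `z ↦ -1/z` on theta functions and characters -/

lemma theta_neg (N : ℕ) (a : ℤ) (z : ℂ) : theta N (-a) z = theta N a z := by
  unfold theta
  rw [← jacobiTheta₂_neg_left, ← jacobiTheta₂_add_left (-(1 / 2 + ((-a : ℤ) : ℂ) * z / 2))]
  congr 2
  · push_cast
    ring
  · push_cast
    ring

lemma theta_add_two_mul {N : ℕ} (hN : N ≠ 0) (a : ℤ) (z : ℂ) :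
    theta N (a + 2 * N) z = -theta N a z := by
  unfold theta
  have hN' : (N : ℂ) ≠ 0 := by exact_mod_cast hN
  have h := jacobiTheta₂_add_left' (1 / 2 + a * z / 2) (N * z)
  rw [show (1 / 2 + ((a + 2 * N : ℤ) : ℂ) * z / 2) = 1 / 2 + a * z / 2 + N * z by push_cast; ring,
    h, ← mul_assoc, ← Complex.exp_add, ← neg_mul]
  congr 1
  have hpi : Complex.exp (-(Real.pi * Complex.I)) = -1 := by
    rw [Complex.exp_neg, Complex.exp_pi_mul_I]
    norm_num
  rw [← neg_one_mul (Complex.exp _)]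
  nth_rw 1 [← hpi]
  rw [← Complex.exp_add]
  congr 1
  push_cast
  field_simp
  ring

lemma theta_self {N : ℕ} (hN : N ≠ 0) (z : ℂ) : theta N N z = 0 := by
  have h := theta_add_two_mul hN (-N) z
  rw [theta_neg, show (-(N : ℤ) + 2 * N) = N by ring] at h
  linear_combination h / 2

/-- The inversion formula for `theta N a`, `a` odd: Poisson summation followed by sorting the
summation index modulo `N`. -/
lemma theta_inversion {N : ℕ} [NeZero N] {a : ℤ} (ha : Odd a) (z : ℍ) :
    theta N a (-1 / z) = 1 / (-Complex.I * (N * (-1 / z))) ^ (1 / 2 : ℂ) *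
      ∑ r : Fin N, Complex.exp (-Real.pi * Complex.I * a * (2 * (r : ℕ) + 1) / (2 * N)) *
        theta N (2 * (r : ℕ) + 1) z := by
  have hN : (N : ℂ) ≠ 0 := by exact_mod_cast NeZero.ne N
  have hz : (z : ℂ) ≠ 0 := z.ne_zero
  have hNpos : (0 : ℝ) < N := by exact_mod_cast Nat.pos_of_ne_zero (NeZero.ne N)
  have hτ : 0 < ((z : ℂ) / N).im := by
    rw [Complex.div_natCast_im]
    exact div_pos z.im_pos hNpos
  have hτ' : 0 < ((N : ℂ) * z).im := by
    rw [← Complex.ofReal_natCast, Complex.im_ofReal_mul]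
    exact mul_pos hNpos z.im_pos
  set c : ℂ := Complex.exp (Real.pi * Complex.I * z / (4 * N) - Real.pi * Complex.I * a / (2 * N))
    with hc
  have hpoisson : theta N a (-1 / z) = 1 / (-Complex.I * (N * (-1 / z))) ^ (1 / 2 : ℂ) *
      (c * jacobiTheta₂ ((z - a) / (2 * N)) (z / N)) := by
    rw [theta, jacobiTheta₂_functional_equation, ← jacobiTheta₂_neg_left ((z - a) / (2 * N))]
    have e1 : (1 / 2 + (a : ℂ) * (-1 / z) / 2) / (N * (-1 / z)) = -((z - a) / (2 * N)) := by
      field_simp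
      ring
    have e2 : -1 / ((N : ℂ) * (-1 / z)) = z / N := by
      field_simp
    have e3 : c = Complex.exp (Real.pi * Complex.I * a ^ 2 * (-1 / z) / (4 * N)) *
        Complex.exp (-Real.pi * Complex.I * (1 / 2 + (a : ℂ) * (-1 / z) / 2) ^ 2 /
          (N * (-1 / z))) := by
      rw [hc, ← Complex.exp_add]
      congr 1
      field_simp
      ring
    rw [e1, e2, e3]
    ring
  rw [hpoisson]
  congr 1
  have hsum := (hasSum_jacobiTheta₂_term ((z - a) / (2 * N)) hτ).mul_left c
  rw [← ((Int.divModEquiv N).trans (Equiv.prodComm _ _)).symm.hasSum_iff] at hsum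
  refine (hsum.prod_fiberwise fun r => ?_).unique (hasSum_fintype _)
  have h := ((hasSum_jacobiTheta₂_term (1 / 2 + ((2 * (r : ℕ) + 1 : ℤ) : ℂ) * z / 2) hτ').mul_left
    (Complex.exp (Real.pi * Complex.I * ((2 * (r : ℕ) + 1 : ℤ) : ℂ) ^ 2 * z / (4 * N)))).mul_left
    (Complex.exp (-Real.pi * Complex.I * a * (2 * (r : ℕ) + 1) / (2 * N)))
  refine h.congr_fun fun m => ?_
  obtain ⟨b, rfl⟩ := ha
  -- The two exponents differ by `-2πi m (b + 1)`, where `a = 2b + 1`: this uses that `a` is odd.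
  simp only [Function.comp_apply, Equiv.symm_trans_apply, Equiv.prodComm_symm, Equiv.prodComm_apply,
    Prod.swap_prod_mk, Int.divModEquiv, Equiv.coe_fn_symm_mk, jacobiTheta₂_term, hc,
    ← Complex.exp_add]
  refine Complex.exp_eq_exp_iff_exists_int.mpr ⟨-(m * (b + 1)), ?_⟩
  push_cast
  field_simp
  ring

/-- The branch of the square root in Poisson summation, compared with `√z`. -/
lemma exists_inv_cpow_eq {N : ℕ} (hN : N ≠ 0) : ∃ C : ℂ, ∀ z : ℍ,
    1 / (-Complex.I * (N * (-1 / z))) ^ (1 / 2 : ℂ) = C * Complex.sqrt z := by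
  refine ⟨Complex.exp (-(Complex.log N + Complex.log Complex.I) / 2), fun z => ?_⟩
  have hz : (z : ℂ) ≠ 0 := z.ne_zero
  have hNpos : (0 : ℝ) < N := by exact_mod_cast Nat.pos_of_ne_zero hN
  -- Both sides are expressed through `x = -iz`, which lies in the right half-plane, away from the
  -- branch cut of the logarithm.
  set x : ℂ := -Complex.I * z with hx
  have hx0 : x ≠ 0 := mul_ne_zero (neg_ne_zero.mpr Complex.I_ne_zero) hz
  have hxre : 0 < x.re := by simpa [hx] using z.im_pos
  have harg : |x.arg| < Real.pi / 2 := Complex.abs_arg_lt_pi_div_two_iff.mpr (Or.inl hxre)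
  rw [abs_lt] at harg
  have hpi := Real.pi_pos
  have e1 : -Complex.I * (N * (-1 / z)) = ((N : ℝ) : ℂ) * x⁻¹ := by
    rw [hx]
    push_cast
    field_simp
    linear_combination Complex.I_sq
  have e2 : (z : ℂ) = x * Complex.I := by
    rw [hx]
    linear_combination (z : ℂ) * Complex.I_sq
  have e3 : Complex.log z = Complex.log x + Complex.log Complex.I := by
    rw [e2, Complex.log_mul hx0 Complex.I_ne_zero]
    rw [Complex.arg_I]
    constructor <;> linarith
  have e4 : Complex.log (((N : ℝ) : ℂ) * x⁻¹) = Complex.log N - Complex.log x := by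
    rw [Complex.log_ofReal_mul hNpos (inv_ne_zero hx0), Complex.log_inv _ (by linarith),
      ← Complex.natCast_log]
    push_cast
    ring
  have e5 : -Complex.I * (N * (-1 / z)) ≠ 0 := by
    rw [e1]
    exact mul_ne_zero (by exact_mod_cast hN) (inv_ne_zero hx0)
  rw [sqrt_eq_exp hz, Complex.cpow_def_of_ne_zero e5, e1, e4, e3, one_div,
    ← Complex.exp_neg, ← Complex.exp_add]
  congr 1
  ring

/-- Every `theta (2k+1) b` with `b` odd is, up to sign, zero or one of the theta functions
attached to the characters. -/
lemma theta_mem_span (k : ℕ) (r : Fin (2 * k + 1)) :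
    (fun z : ℍ => theta (2 * k + 1) (2 * (r : ℕ) + 1) z) ∈ Submodule.span ℂ
      (Set.range fun (j : Fin k) (z : ℍ) =>
        theta (2 * k + 1) (2 * k + 1 - 2 * ((j : ℕ) + 1 : ℕ)) z) := by
  obtain ⟨r, hr⟩ := r
  have hlt (r : ℕ) (hr : r < k) : (fun z : ℍ => theta (2 * k + 1) (2 * r + 1) z) ∈
      Submodule.span ℂ (Set.range fun (j : Fin k) (z : ℍ) =>
        theta (2 * k + 1) (2 * k + 1 - 2 * ((j : ℕ) + 1 : ℕ)) z) := by
    refine Submodule.subset_span ⟨⟨k - 1 - r, by lia⟩, ?_⟩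
    have : (2 * k + 1 - 2 * (((k - 1 - r : ℕ) : ℕ) + 1 : ℕ) : ℤ) = 2 * r + 1 := by lia
    simp only [this]
  rcases lt_trichotomy r k with h | rfl | h
  · exact hlt r h
  · have : (fun z : ℍ => theta (2 * r + 1) (2 * r + 1) z) = 0 := by
      funext z
      exact_mod_cast theta_self (N := 2 * r + 1) (by lia) z
    simp only [this]
    exact Submodule.zero_mem _
  · have : (fun z : ℍ => theta (2 * k + 1) (2 * r + 1) z) =
        -fun z : ℍ => theta (2 * k + 1) (2 * (2 * k - r : ℕ) + 1) z := by
      funext z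
      have h1 := theta_add_two_mul (N := 2 * k + 1) (by lia) (-(2 * (2 * k - r : ℕ) + 1)) z
      rw [theta_neg] at h1
      rw [Pi.neg_apply, ← h1]
      congr 1
      lia
    simp only [this]
    exact Submodule.neg_mem _ (hlt _ (by lia))

/-- The characters span a representation of the inversion: `ch_i(-1/z)` is a linear combination of
the `ch_j(z)`. -/
theorem exists_character_S_smul (k : ℕ) : ∃ M : Fin k → Fin k → ℂ, ∀ (i : Fin k) (z : ℍ),
    character ((i : ℕ) + 1) k (ModularGroup.S • z) =
      ∑ j, M i j * character ((j : ℕ) + 1) k z := by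
  obtain ⟨C, hC⟩ := exists_inv_cpow_eq (N := 2 * k + 1) (by lia)
  -- The factors `√z` from the theta functions and from `η` cancel in the quotient.
  have key (i : Fin k) : ∃ M : Fin k → ℂ, ∀ z : ℍ,
      theta (2 * k + 1) (2 * k + 1 - 2 * ((i : ℕ) + 1 : ℕ)) (-1 / z) = Complex.sqrt z *
        ∑ j : Fin k, M j * theta (2 * k + 1) (2 * k + 1 - 2 * ((j : ℕ) + 1 : ℕ)) z := by
    have hmem : (C • ∑ r : Fin (2 * k + 1), Complex.exp (-Real.pi * Complex.I *
        ((2 * k + 1 - 2 * ((i : ℕ) + 1 : ℕ) : ℤ) : ℂ) * (2 * (r : ℕ) + 1) /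
          (2 * (2 * k + 1 : ℕ))) • fun z : ℍ => theta (2 * k + 1) (2 * (r : ℕ) + 1) z) ∈
        Submodule.span ℂ (Set.range fun (j : Fin k) (z : ℍ) =>
          theta (2 * k + 1) (2 * k + 1 - 2 * ((j : ℕ) + 1 : ℕ)) z) :=
      Submodule.smul_mem _ _ (Submodule.sum_mem _ fun r _ =>
        Submodule.smul_mem _ _ (theta_mem_span k r))
    obtain ⟨M, hM⟩ := (Submodule.mem_span_range_iff_exists_fun ℂ).mp hmem
    refine ⟨M, fun z => ?_⟩
    rw [theta_inversion ⟨(k - ((i : ℕ) + 1 : ℕ) : ℤ), by ring⟩, hC]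
    have := congrFun hM z
    simp only [Finset.sum_apply, Pi.smul_apply, smul_eq_mul] at this
    rw [this]
    ring
  choose M hM using key
  refine ⟨fun i j => Complex.sqrt Complex.I * M i j, fun i z => ?_⟩
  have hη : ModularForm.eta (-1 / z) =
      (Complex.sqrt Complex.I)⁻¹ * (Complex.sqrt z * ModularForm.eta z) :=
    ModularForm.eta_comp_eq_csqrt_I_inv z.2
  have hS : ((ModularGroup.S • z : ℍ) : ℂ) = -1 / z := by
    rw [UpperHalfPlane.modular_S_smul]
    simp [neg_div]
  have hsI : Complex.sqrt Complex.I ≠ 0 := by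
    rw [sqrt_eq_exp Complex.I_ne_zero]
    exact Complex.exp_ne_zero _
  have hsz : Complex.sqrt z ≠ 0 := by
    rw [sqrt_eq_exp z.ne_zero]
    exact Complex.exp_ne_zero _
  have hηz := ModularForm.eta_ne_zero z.2
  rw [character_eq_theta_div_eta (by lia) (by lia), hS, hM, hη]
  have (j : Fin k) := character_eq_theta_div_eta (i := (j : ℕ) + 1) (k := k) (by lia) (by lia) z
  simp_rw [this, mul_div_assoc', ← Finset.sum_div, mul_assoc, ← Finset.mul_sum]
  field_simp

/-! ### The Wronskian near the cusp -/

/-- The operator on functions of `q` which corresponds to `q d/dq` on functions `q^r G(q)`. -/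
noncomputable def twistedDeriv (r : ℂ) (G : ℂ → ℂ) (q : ℂ) : ℂ := r * G q + q * deriv G q

lemma differentiableOn_twistedDeriv {G : ℂ → ℂ} (hG : DifferentiableOn ℂ G (Metric.ball 0 1))
    (r : ℂ) : DifferentiableOn ℂ (twistedDeriv r G) (Metric.ball 0 1) :=
  (hG.const_mul r).add (differentiableOn_id.mul (hG.deriv Metric.isOpen_ball))

lemma differentiableOn_iterate_twistedDeriv {G : ℂ → ℂ}
    (hG : DifferentiableOn ℂ G (Metric.ball 0 1)) (r : ℂ) (n : ℕ) :
    DifferentiableOn ℂ ((twistedDeriv r)^[n] G) (Metric.ball 0 1) := by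
  induction n with
  | zero => exact hG
  | succ n ih =>
    rw [Function.iterate_succ_apply']
    exact differentiableOn_twistedDeriv ih r

lemma iterate_twistedDeriv_zero (r : ℂ) (G : ℂ → ℂ) (n : ℕ) :
    (twistedDeriv r)^[n] G 0 = r ^ n * G 0 := by
  induction n with
  | zero => simp
  | succ n ih =>
    rw [Function.iterate_succ_apply', twistedDeriv, ih]
    ring

lemma hasDerivAt_exp_mul_comp {G : ℂ → ℂ} (hG : DifferentiableOn ℂ G (Metric.ball 0 1))
    (r : ℂ) (z : ℍ) :
    HasDerivAt (fun w : ℂ => Complex.exp (2 * Real.pi * Complex.I * r * w) *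
        G (Complex.exp (2 * Real.pi * Complex.I * w)))
      (2 * Real.pi * Complex.I * (Complex.exp (2 * Real.pi * Complex.I * r * z) *
        twistedDeriv r G (Complex.exp (2 * Real.pi * Complex.I * z)))) z := by
  have hq : Complex.exp (2 * Real.pi * Complex.I * z) ∈ Metric.ball (0 : ℂ) 1 := by
    simpa using norm_exp_lt_one z
  have h1 (c : ℂ) : HasDerivAt (fun w : ℂ => Complex.exp (c * w)) (Complex.exp (c * z) * c) z := by
    simpa using ((hasDerivAt_id (z : ℂ)).const_mul c).cexp
  have h2 := ((hG.differentiableAt (Metric.isOpen_ball.mem_nhds hq)).hasDerivAt).comp (z : ℂ)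
    (h1 (2 * Real.pi * Complex.I))
  refine ((h1 (2 * Real.pi * Complex.I * r)).mul h2).congr_deriv ?_
  simp only [twistedDeriv, Function.comp_apply]
  ring

lemma comp_ofComplex_eventuallyEq (r : ℚ) (G : ℂ → ℂ) (z : ℍ) :
    (fun z : ℍ => qPow r z * G (Complex.exp (2 * Real.pi * Complex.I * z))) ∘
        UpperHalfPlane.ofComplex =ᶠ[𝓝 (z : ℂ)]
      fun w : ℂ => Complex.exp (2 * Real.pi * Complex.I * r * w) *
        G (Complex.exp (2 * Real.pi * Complex.I * w)) := by
  filter_upwards [UpperHalfPlane.isOpen_upperHalfPlaneSet.mem_nhds z.2] with w hw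
  simp [qPow, UpperHalfPlane.ofComplex_apply_of_im_pos hw]

lemma mdifferentiable_qPow_mul {G : ℂ → ℂ} (hG : DifferentiableOn ℂ G (Metric.ball 0 1)) (r : ℚ) :
    MDiff fun z : ℍ => qPow r z * G (Complex.exp (2 * Real.pi * Complex.I * z)) := fun z =>
  UpperHalfPlane.mdifferentiableAt_iff.mpr
    (((hasDerivAt_exp_mul_comp hG r z).congr_of_eventuallyEq
      (comp_ofComplex_eventuallyEq r G z)).differentiableAt)

lemma normalizedDeriv_qPow_mul {G : ℂ → ℂ} (hG : DifferentiableOn ℂ G (Metric.ball 0 1)) (r : ℚ) :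
    Derivative.normalizedDerivOfComplex
        (fun z : ℍ => qPow r z * G (Complex.exp (2 * Real.pi * Complex.I * z))) =
      fun z => qPow r z * twistedDeriv r G (Complex.exp (2 * Real.pi * Complex.I * z)) := by
  funext z
  rw [Derivative.normalizedDerivOfComplex, ((hasDerivAt_exp_mul_comp hG r z).congr_of_eventuallyEq
      (comp_ofComplex_eventuallyEq r G z)).deriv, qPow]
  exact inv_mul_cancel_left₀ Complex.two_pi_I_ne_zero _

lemma iterate_normalizedDeriv_qPow_mul {G : ℂ → ℂ} (hG : DifferentiableOn ℂ G (Metric.ball 0 1))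
    (r : ℚ) (n : ℕ) :
    Derivative.normalizedDerivOfComplex^[n]
        (fun z : ℍ => qPow r z * G (Complex.exp (2 * Real.pi * Complex.I * z))) =
      fun z => qPow r z * (twistedDeriv r)^[n] G (Complex.exp (2 * Real.pi * Complex.I * z)) := by
  induction n with
  | zero => rfl
  | succ n ih =>
    rw [Function.iterate_succ_apply', ih,
      normalizedDeriv_qPow_mul (differentiableOn_iterate_twistedDeriv hG r n),
      Function.iterate_succ_apply']

lemma qPow_add (r s : ℚ) (z : ℍ) : qPow (r + s) z = qPow r z * qPow s z := by
  rw [qPow, qPow, qPow, ← Complex.exp_add]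
  congr 1
  push_cast
  ring

lemma qPow_sum {ι : Type*} (s : Finset ι) (r : ι → ℚ) (z : ℍ) :
    qPow (∑ i ∈ s, r i) z = ∏ i ∈ s, qPow (r i) z := by
  classical
  induction s using Finset.induction_on with
  | empty => simp [qPow]
  | insert a s ha ih => rw [Finset.sum_insert ha, Finset.prod_insert ha, qPow_add, ih]

/-- If `f_i = q^{r_i} G_i(q)` with `G_i` holomorphic on the unit disc, the Wronskian of the `f_i`
is `q^{∑ r_i} H(q)` with `H` holomorphic on the unit disc, and `H(0)` is a multiple of the
Vandermonde determinant of the exponents. -/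
theorem exists_wronskian_eq {n : ℕ} (r : Fin n → ℚ) (G : Fin n → ℂ → ℂ)
    (hG : ∀ i, DifferentiableOn ℂ (G i) (Metric.ball 0 1)) :
    ∃ H : ℂ → ℂ, DifferentiableOn ℂ H (Metric.ball 0 1) ∧
      H 0 = (∏ i, G i 0) * (Matrix.vandermonde fun i => (r i : ℂ)).det ∧
      ∀ z : ℍ, wronskian (fun i (z : ℍ) => qPow (r i) z *
          G i (Complex.exp (2 * Real.pi * Complex.I * z))) z =
        qPow (∑ i, r i) z * H (Complex.exp (2 * Real.pi * Complex.I * z)) := by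
  refine ⟨fun q => Matrix.det (Matrix.of fun j i : Fin n => (twistedDeriv (r i))^[(j : ℕ)] (G i) q),
    ?_, ?_, fun z => ?_⟩
  · simp only [Matrix.det_apply, Matrix.of_apply]
    refine DifferentiableOn.fun_sum fun σ _ => DifferentiableOn.const_smul ?_ _
    exact DifferentiableOn.fun_finsetProd fun i _ =>
      differentiableOn_iterate_twistedDeriv (hG i) _ _
  · simp only [iterate_twistedDeriv_zero]
    rw [← Matrix.det_transpose (Matrix.vandermonde _), ← Matrix.det_mul_row]
    congr 1
    ext j i
    simp [Matrix.vandermonde_apply, mul_comm]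
  · rw [wronskian, qPow_sum, ← Matrix.det_mul_row]
    congr 1
    ext j i
    simp only [Matrix.of_apply]
    rw [iterate_normalizedDeriv_qPow_mul (hG i)]

/-- The exponents `h_{i,k} - c_k/24` sum to `k(k-1)/12`, the exponent of `η^{2k(k-1)}`. -/
lemma sum_weights (k : ℕ) :
    ∑ i : Fin k, (lowestWeight ((i : ℕ) + 1) k - centralCharge k / 24) = (k * (k - 1) : ℚ) / 12 := by
  have h (i : ℕ) : lowestWeight (i + 1) k - centralCharge k / 24 =
      (2 * k - 1 - 2 * i) ^ 2 / (8 * (2 * k + 1)) - 1 / 24 := by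
    have := lowestWeight_sub (i + 1) k
    push_cast at this
    rw [eq_sub_iff_add_eq, this]
    ring
  have hs (n : ℕ) (c : ℚ) : ∑ i ∈ Finset.range n, (c - 2 * i) ^ 2 =
      n * c ^ 2 - 2 * c * (n * (n - 1)) + 2 * n * (n - 1) * (2 * n - 1) / 3 := by
    induction n with
    | zero => simp
    | succ n ih =>
      rw [Finset.sum_range_succ, ih]
      push_cast
      ring
  rw [Fin.sum_univ_eq_sum_range
    (fun i => lowestWeight (i + 1) k - centralCharge k / 24) k]
  simp_rw [h]
  rw [Finset.sum_sub_distrib, ← Finset.sum_div, hs]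
  have : (2 * (k : ℚ) + 1) ≠ 0 := by positivity
  simp only [Finset.sum_const, Finset.card_range, nsmul_eq_mul]
  field_simp
  ring

lemma weights_injective (k : ℕ) : Function.Injective fun i : Fin k =>
    ((lowestWeight ((i : ℕ) + 1) k - centralCharge k / 24 : ℚ) : ℂ) := by
  intro i j hij
  have h : lowestWeight ((i : ℕ) + 1) k = lowestWeight ((j : ℕ) + 1) k := by
    simpa using (Rat.cast_injective hij : _ = _)
  have hk : (2 * (k : ℚ) + 1) ≠ 0 := by positivity
  unfold lowestWeight at h
  rw [div_left_inj' (by positivity), sub_left_inj] at h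
  push_cast at h
  have hi : ((i : ℕ) : ℚ) + 1 ≤ k := by exact_mod_cast i.2
  have hj : ((j : ℕ) : ℚ) + 1 ≤ k := by exact_mod_cast j.2
  have h2 : 2 * ((k : ℚ) - ((i : ℕ) + 1)) + 1 = 2 * ((k : ℚ) - ((j : ℕ) + 1)) + 1 :=
    (sq_eq_sq₀ (by linarith) (by linarith)).mp h
  have h3 : ((i : ℕ) : ℚ) = (j : ℕ) := by linarith
  exact Fin.ext (by exact_mod_cast h3)

lemma differentiableOn_inv_partialEuler {S : Set ℕ} (hS : 0 ∉ S) :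
    DifferentiableOn ℂ (fun q => (partialEuler S q)⁻¹) (Metric.ball 0 1) :=
  (differentiableOn_partialEuler S).inv fun _ hq => partialEuler_ne_zero hS (by simpa using hq)

lemma character_eq_fun (i k : ℕ) : character i k = fun z : ℍ =>
    qPow (lowestWeight i k - centralCharge k / 24) z *
      (fun q => (partialEuler (parts i k) q)⁻¹) (Complex.exp (2 * Real.pi * Complex.I * z)) :=
  funext (character_eq i k)

lemma mdifferentiable_character (i k : ℕ) : MDiff (character i k) := by
  rw [character_eq_fun]
  exact mdifferentiable_qPow_mul (differentiableOn_inv_partialEuler (zero_notMem_parts i k)) _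

/-- The Wronskian of the characters is `q^{k(k-1)/12} H(q)` with `H` holomorphic on the unit disc
and `H(0) ≠ 0`. -/
theorem exists_wronskian_character_eq (k : ℕ) :
    ∃ H : ℂ → ℂ, DifferentiableOn ℂ H (Metric.ball 0 1) ∧ H 0 ≠ 0 ∧
      ∀ z : ℍ, wronskian (fun i : Fin k => character ((i : ℕ) + 1) k) z =
        qPow ((k * (k - 1) : ℚ) / 12) z * H (Complex.exp (2 * Real.pi * Complex.I * z)) := by
  obtain ⟨H, hH, hH0, hW⟩ := exists_wronskian_eq
    (fun i : Fin k => lowestWeight ((i : ℕ) + 1) k - centralCharge k / 24)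
    (fun i : Fin k => fun q => (partialEuler (parts ((i : ℕ) + 1) k) q)⁻¹)
    (fun i => differentiableOn_inv_partialEuler (zero_notMem_parts _ _))
  refine ⟨H, hH, ?_, fun z => ?_⟩
  · rw [hH0]
    refine mul_ne_zero ?_ (Matrix.det_vandermonde_ne_zero_iff.mpr (weights_injective k))
    simp [partialEuler_zero (zero_notMem_parts _ _)]
  · simp_rw [character_eq_fun]
    rw [hW, sum_weights]

/-- `η^{2k(k-1)}` has the same leading exponent as the Wronskian of the characters. -/
lemma eta_pow_eq (k : ℕ) (z : ℍ) : ModularForm.eta z ^ (2 * k * (k - 1)) =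
    qPow ((k * (k - 1) : ℚ) / 12) z *
      (∏' n : ℕ, (1 - Complex.exp (2 * Real.pi * Complex.I * z) ^ (n + 1))) ^
        (2 * k * (k - 1)) := by
  rw [ModularForm.eta, mul_pow]
  simp only [ModularForm.eta_q_eq_pow]
  congr 1
  rw [Function.Periodic.qParam, qPow, ← Complex.exp_nat_mul]
  congr 1
  rcases k with _ | k
  · simp
  · push_cast
    ring

/-! ### The Wronskian under inversion -/

lemma mdifferentiable_iterate_normalizedDeriv {f : ℍ → ℂ} (hf : MDiff f) (n : ℕ) :
    MDiff (D^[n] f) := by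
  induction n with
  | zero => exact hf
  | succ n ih =>
    rw [Function.iterate_succ_apply']
    exact Derivative.normalizedDerivOfComplex_mdifferentiable ih

lemma slash_zero_S (f : ℍ → ℂ) : SlashAction.map (0 : ℤ) ModularGroup.S f =
    fun z => f (ModularGroup.S • z) := by
  funext z
  simp [ModularForm.SL_slash_apply]

lemma mdifferentiable_comp_S_smul {f : ℍ → ℂ} (hf : MDiff f) :
    MDiff fun z : ℍ => f (ModularGroup.S • z) := by
  rw [← slash_zero_S]
  exact hf.slash 0 _

lemma normalizedDeriv_comp_S_smul {f : ℍ → ℂ} (hf : MDiff f) :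
    D (fun z : ℍ => f (ModularGroup.S • z)) =
      fun z : ℍ => ((z : ℂ) ^ 2)⁻¹ * D f (ModularGroup.S • z) := by
  rw [← slash_zero_S, Derivative.normalizedDerivOfComplex_SL_slash hf]
  funext z
  simp [ModularForm.SL_slash_apply, ModularGroup.denom_S, mul_comm]

lemma mdifferentiable_inv_sq : MDiff fun z : ℍ => ((z : ℂ) ^ 2)⁻¹ := fun z => by
  rw [UpperHalfPlane.mdifferentiableAt_iff]
  have : DifferentiableAt ℂ (fun w : ℂ => (w ^ 2)⁻¹) z :=
    (differentiableAt_id.pow 2).inv (pow_ne_zero 2 z.ne_zero)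
  refine this.congr_of_eventuallyEq ?_
  filter_upwards [UpperHalfPlane.isOpen_upperHalfPlaneSet.mem_nhds z.2] with w hw
  simp [UpperHalfPlane.ofComplex_apply_of_im_pos hw]

/-- The coefficients in the chain rule `D^n (f ∘ S) = ∑_m c_{n,m} (D^m f) ∘ S`. -/
noncomputable def chainCoeff : ℕ → ℕ → ℍ → ℂ
  | 0, 0 => fun _ => 1
  | 0, _ + 1 => fun _ => 0
  | n + 1, 0 => D (chainCoeff n 0)
  | n + 1, m + 1 => D (chainCoeff n (m + 1)) + (fun z : ℍ => ((z : ℂ) ^ 2)⁻¹) * chainCoeff n m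

lemma mdifferentiable_chainCoeff (n m : ℕ) : MDiff (chainCoeff n m) := by
  induction n generalizing m with
  | zero => cases m <;> exact mdifferentiable_const
  | succ n ih =>
    cases m with
    | zero => exact Derivative.normalizedDerivOfComplex_mdifferentiable (ih 0)
    | succ m =>
      exact (Derivative.normalizedDerivOfComplex_mdifferentiable (ih (m + 1))).add
        (mdifferentiable_inv_sq.mul (ih m))

lemma chainCoeff_of_lt {n m : ℕ} (h : n < m) : chainCoeff n m = 0 := by
  induction n generalizing m with
  | zero =>
    cases m with
    | zero => lia
    | succ m => rfl
  | succ n ih =>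
    cases m with
    | zero => lia
    | succ m =>
      rw [chainCoeff, ih (by lia), ih (by lia), mul_zero, add_zero]
      exact Derivative.normalizedDerivOfComplex_const 0

lemma chainCoeff_self (n : ℕ) (z : ℍ) : chainCoeff n n z = (((z : ℂ) ^ 2)⁻¹) ^ n := by
  induction n with
  | zero => simp [chainCoeff]
  | succ n ih =>
    have h0 : D (0 : ℍ → ℂ) = 0 := Derivative.normalizedDerivOfComplex_const 0
    rw [chainCoeff, chainCoeff_of_lt (by lia), h0, zero_add, Pi.mul_apply, ih,
      pow_succ' (((z : ℂ) ^ 2)⁻¹) n]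

lemma mdifferentiable_finset_sum {ι : Type*} (s : Finset ι) {f : ι → ℍ → ℂ}
    (hf : ∀ i, MDiff (f i)) : MDiff (∑ i ∈ s, f i) := by
  classical
  induction s using Finset.induction_on with
  | empty => exact mdifferentiable_const
  | insert a s ha ih =>
    rw [Finset.sum_insert ha]
    exact (hf a).add ih

lemma normalizedDeriv_finset_sum {ι : Type*} (s : Finset ι) {f : ι → ℍ → ℂ}
    (hf : ∀ i, MDiff (f i)) : D (∑ i ∈ s, f i) = ∑ i ∈ s, D (f i) := by
  classical
  induction s using Finset.induction_on with
  | empty => exact Derivative.normalizedDerivOfComplex_const 0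
  | insert a s ha ih =>
    rw [Finset.sum_insert ha, Finset.sum_insert ha,
      Derivative.normalizedDerivOfComplex_add _ _ (hf a) (mdifferentiable_finset_sum s hf), ih]

lemma iterate_normalizedDeriv_comp_S_smul {f : ℍ → ℂ} (hf : MDiff f) {n K : ℕ} (hn : n < K) :
    D^[n] (fun z : ℍ => f (ModularGroup.S • z)) =
      ∑ m ∈ Finset.range K, chainCoeff n m * fun z : ℍ => (D^[m] f) (ModularGroup.S • z) := by
  obtain ⟨K, rfl⟩ : ∃ L, K = L + 1 := ⟨K - 1, by lia⟩
  induction n with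
  | zero =>
    rw [Finset.sum_range_succ']
    funext z
    simp [chainCoeff]
  | succ n ih =>
    have hmd (m : ℕ) := mdifferentiable_comp_S_smul (mdifferentiable_iterate_normalizedDeriv hf m)
    rw [Function.iterate_succ_apply', ih (by lia), normalizedDeriv_finset_sum _ fun m =>
      (mdifferentiable_chainCoeff n m).mul (hmd m)]
    have hterm (m : ℕ) : D (chainCoeff n m * fun z : ℍ => (D^[m] f) (ModularGroup.S • z)) =
        D (chainCoeff n m) * (fun z : ℍ => (D^[m] f) (ModularGroup.S • z)) +
        (fun z : ℍ => ((z : ℂ) ^ 2)⁻¹) * chainCoeff n m *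
          fun z : ℍ => (D^[m + 1] f) (ModularGroup.S • z) := by
      rw [Derivative.normalizedDerivOfComplex_mul _ _ (mdifferentiable_chainCoeff n m) (hmd m),
        normalizedDeriv_comp_S_smul (mdifferentiable_iterate_normalizedDeriv hf m)]
      funext z
      simp only [Pi.add_apply, Pi.mul_apply, Function.iterate_succ_apply']
      ring
    simp_rw [hterm]
    rw [Finset.sum_add_distrib, Finset.sum_range_succ' _ K, Finset.sum_range_succ _ K,
      Finset.sum_range_succ' _ K, chainCoeff_of_lt (show n < K by lia)]
    simp only [chainCoeff, add_mul, Finset.sum_add_distrib, mul_zero, zero_mul]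
    ring

/-- The Wronskian of weight-zero functions transforms with weight `n(n-1)` under inversion. -/
theorem wronskian_comp_S_smul {n : ℕ} {f : Fin n → ℍ → ℂ} (hf : ∀ i, MDiff (f i)) (z : ℍ) :
    wronskian (fun i (z : ℍ) => f i (ModularGroup.S • z)) z =
      ((z : ℂ) ^ (n * (n - 1)))⁻¹ * wronskian f (ModularGroup.S • z) := by
  set C : Matrix (Fin n) (Fin n) ℂ := Matrix.of fun j m => chainCoeff (j : ℕ) (m : ℕ) z with hC
  have hmul : (Matrix.of fun j i : Fin n =>
        (D^[(j : ℕ)] (fun z : ℍ => f i (ModularGroup.S • z))) z) =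
      C * Matrix.of fun j i : Fin n => (D^[(j : ℕ)] (f i)) (ModularGroup.S • z) := by
    ext j i
    rw [Matrix.of_apply, iterate_normalizedDeriv_comp_S_smul (hf i) j.2, Finset.sum_apply,
      Matrix.mul_apply, ← Fin.sum_univ_eq_sum_range
        (fun m => (chainCoeff j m * fun z : ℍ => (D^[m] (f i)) (ModularGroup.S • z)) z) n]
    rfl
  have hdet : C.det = ((z : ℂ) ^ (n * (n - 1)))⁻¹ := by
    rw [Matrix.det_of_isLowerTriangular C fun i j hij => by
      simp [hC, chainCoeff_of_lt (show (i : ℕ) < (j : ℕ) from hij)]]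
    simp only [hC, Matrix.of_apply, chainCoeff_self]
    rw [Fin.prod_univ_eq_prod_range (fun m => (((z : ℂ) ^ 2)⁻¹) ^ m) n, Finset.prod_pow_eq_pow_sum,
      ← inv_pow, ← inv_pow, ← pow_mul, ← Finset.sum_range_id_mul_two, mul_comm 2]
  rw [wronskian, hmul, Matrix.det_mul, hdet, wronskian]

/-- A linear change of the functions multiplies the Wronskian by a constant. -/
lemma wronskian_linear_combination {n : ℕ} {f : Fin n → ℍ → ℂ} (hf : ∀ i, MDiff (f i))
    (M : Fin n → Fin n → ℂ) (z : ℍ) :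
    wronskian (fun i z => ∑ j, M i j * f j z) z = (Matrix.of M).det * wronskian f z := by
  have hD (i : Fin n) (m : ℕ) : D^[m] (fun z => ∑ j, M i j * f j z) =
      ∑ j, M i j • D^[m] (f j) := by
    induction m with
    | zero =>
      funext z
      simp
    | succ m ih =>
      rw [Function.iterate_succ_apply', ih, normalizedDeriv_finset_sum _ fun j =>
        (mdifferentiable_iterate_normalizedDeriv (hf j) m).const_smul (M i j)]
      refine Finset.sum_congr rfl fun j _ => ?_
      rw [Derivative.normalizedDerivOfComplex_smul _ _
        (mdifferentiable_iterate_normalizedDeriv (hf j) m), Function.iterate_succ_apply']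
  have hmul : (Matrix.of fun j i : Fin n => (D^[(j : ℕ)] (fun z => ∑ l, M i l * f l z)) z) =
      (Matrix.of fun j i : Fin n => (D^[(j : ℕ)] (f i)) z) * (Matrix.of M).transpose := by
    ext j i
    rw [Matrix.of_apply, hD]
    simp [Matrix.mul_apply, mul_comm]
  rw [wronskian, hmul, Matrix.det_mul, Matrix.det_transpose, mul_comm, wronskian]

/-! ### Rigidity of modular functions -/

/-- A holomorphic function invariant under the modular group with a limit at `i∞` is constant. -/
lemma eq_const_of_invariant {f : ℍ → ℂ} (hf : MDiff f)
    (hT : ∀ z, f (ModularGroup.T • z) = f z) (hS : ∀ z, f (ModularGroup.S • z) = f z) {L : ℂ}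
    (hL : Tendsto f UpperHalfPlane.atImInfty (𝓝 L)) (z : ℍ) : f z = L := by
  have hsl := SlashInvariantForm.slash_action_generators_SL2Z (f := f) (k := 0)
    (by rw [slash_zero_S]; exact funext hS)
    (by
      funext z
      rw [ModularForm.SL_slash_apply, hT, neg_zero, zpow_zero, mul_one])
  let g : ModularForm (Matrix.SpecialLinearGroup.mapGL ℝ).range 0 :=
    { toFun := f
      slash_action_eq' := by
        rintro _ ⟨γ, rfl⟩
        exact hsl γ
      holo' := hf
      bdd_at_cusps' := fun hc => by
        rw [Subgroup.IsArithmetic.isCusp_iff_isCusp_SL2Z] at hc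
        rw [OnePoint.isBoundedAt_iff_forall_SL2Z hc]
        intro γ _
        rw [hsl γ]
        exact hL.isBigO_one ℝ }
  obtain ⟨c, hc⟩ := ModularFormClass.levelOne_weight_zero_const g
  have hfc : f = Function.const ℍ c := hc
  have : c = L := tendsto_nhds_unique (by rw [hfc]; exact tendsto_const_nhds) hL
  rw [hfc, ← this]
  rfl

/-- The same, when `f` is only known to be multiplied by some constant under inversion, provided
the limit is not zero. -/
lemma eq_const_of_quasi_invariant {f : ℍ → ℂ} (hf : MDiff f)
    (hT : ∀ z, f (ModularGroup.T • z) = f z) {ε : ℂ}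
    (hS : ∀ z, f (ModularGroup.S • z) = ε * f z) {L : ℂ} (hL0 : L ≠ 0)
    (hL : Tendsto f UpperHalfPlane.atImInfty (𝓝 L)) (z : ℍ) : f z = L := by
  have hSS (z : ℍ) : ModularGroup.S • ModularGroup.S • z = z := by
    apply UpperHalfPlane.ext
    rw [UpperHalfPlane.modular_S_smul, UpperHalfPlane.modular_S_smul]
    simp
  have hSI : ModularGroup.S • UpperHalfPlane.I = UpperHalfPlane.I := by
    apply UpperHalfPlane.ext
    rw [UpperHalfPlane.modular_S_smul]
    simp
  obtain ⟨w, hw⟩ : ∃ w, f w ≠ 0 := (hL.eventually_ne hL0).exists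
  -- As `S` is an involution on `ℍ`, applying `hS` twice determines `ε` up to sign.
  have hε : ε ^ 2 = 1 := by
    have h := hS (ModularGroup.S • w)
    rw [hSS, hS] at h
    have : (ε ^ 2 - 1) * f w = 0 := by linear_combination -h
    rcases mul_eq_zero.mp this with h | h
    · linear_combination h
    · exact absurd h hw
  -- `f²` is invariant, hence constant, so `f` does not vanish at the fixed point `i` of `S`.
  have hsq := eq_const_of_invariant (f := f ^ 2) (hf.pow 2)
    (fun z => by rw [Pi.pow_apply, Pi.pow_apply, hT])
    (fun z => by rw [Pi.pow_apply, Pi.pow_apply, hS, mul_pow, hε, one_mul]) (hL.pow 2) UpperHalfPlane.I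
  have hI : f UpperHalfPlane.I ≠ 0 := by
    intro h
    rw [Pi.pow_apply, h] at hsq
    exact pow_ne_zero 2 hL0 (by simpa using hsq.symm)
  have hε1 : ε = 1 := by
    have h := hS UpperHalfPlane.I
    rw [hSI] at h
    exact (mul_eq_right₀ hI).mp h.symm
  exact eq_const_of_invariant hf hT (fun z => by rw [hS, hε1, one_mul]) hL z

/-! ### Leading coefficients -/

lemma norm_qPow (s : ℚ) (z : ℍ) : ‖qPow s z‖ = Real.exp (-(2 * Real.pi * s * z.im)) := by
  rw [qPow, Complex.norm_exp]
  congr 1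
  rw [show 2 * (Real.pi : ℂ) * Complex.I * (s : ℂ) * (z : ℂ) =
    ((2 * Real.pi * s : ℝ) : ℂ) * (z * Complex.I) by push_cast; ring, Complex.re_ofReal_mul]
  simp

lemma tendsto_qPow_zero {s : ℚ} (hs : 0 < s) :
    Tendsto (qPow s) UpperHalfPlane.atImInfty (𝓝 0) := by
  rw [tendsto_zero_iff_norm_tendsto_zero]
  simp_rw [norm_qPow]
  have hs' : (0 : ℝ) < s := by exact_mod_cast hs
  have him : Tendsto UpperHalfPlane.im UpperHalfPlane.atImInfty atTop := tendsto_comap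
  exact Real.tendsto_exp_neg_atTop_nhds_zero.comp (him.const_mul_atTop (by positivity))

lemma tendsto_exp_two_pi_I :
    Tendsto (fun z : ℍ => Complex.exp (2 * Real.pi * Complex.I * z)) UpperHalfPlane.atImInfty
      (𝓝 0) := by
  refine (tendsto_qPow_zero one_pos).congr fun z => ?_
  simp [qPow]

lemma eq_zero_of_tendsto_qPow {s : ℚ} {L : ℂ} (hL : L ≠ 0)
    (h : Tendsto (qPow s) UpperHalfPlane.atImInfty (𝓝 L)) : s = 0 := by
  rcases lt_trichotomy s 0 with hs | hs | hs
  -- If `s < 0`, then `1 = q^{-s} q^s` would tend to `0 * L`.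
  · have h1 := (tendsto_qPow_zero (neg_pos.mpr hs)).mul h
    rw [zero_mul] at h1
    have h2 : Tendsto (fun _ : ℍ => (1 : ℂ)) UpperHalfPlane.atImInfty (𝓝 0) :=
      h1.congr fun z => by rw [← qPow_add]; simp [qPow]
    exact absurd (tendsto_nhds_unique tendsto_const_nhds h2) one_ne_zero
  · exact hs
  · exact absurd (tendsto_nhds_unique h (tendsto_qPow_zero hs)) hL

/-- The leading coefficient of a `q`-expansion is a limit at `i∞`. -/
lemma HasLeadingCoeff.exists_tendsto {f : ℍ → ℂ} {c : ℂ} (h : HasLeadingCoeff f c) :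
    ∃ r : ℚ, Tendsto (fun z => qPow (-r) z * f z) UpperHalfPlane.atImInfty (𝓝 c) := by
  obtain ⟨_, r, N, b, hN, rfl, hsum⟩ := h
  refine ⟨r, ?_⟩
  have hN' : (0 : ℚ) < N := by exact_mod_cast hN
  have hsum' (z : ℍ) : HasSum (fun n : ℕ => b n * qPow ((n : ℚ) / N) z) (qPow (-r) z * f z) := by
    refine ((hsum z).mul_left (qPow (-r) z)).congr_fun fun n => ?_
    rw [qPow_add, mul_left_comm, ← mul_assoc (qPow (-r) z), ← qPow_add]
    simp [qPow]
  simp_rw [← (hsum' _).tsum_eq]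
  rw [← tsum_ite_eq (0 : ℕ) b]
  -- For `Im z ≥ 1` the expansion is dominated by the convergent one at `z = i`.
  refine tendsto_tsum_of_dominated_convergence
    (bound := fun n => ‖b n * qPow ((n : ℚ) / N) UpperHalfPlane.I‖)
    (hsum' UpperHalfPlane.I).summable.norm (fun n => ?_) ?_
  · rcases Nat.eq_zero_or_pos n with rfl | hn
    · simp [qPow]
    · rw [if_neg hn.ne']
      have hn' : (0 : ℚ) < n := by exact_mod_cast hn
      simpa using (tendsto_qPow_zero (div_pos hn' hN')).const_mul (b n)
  · have him : Tendsto UpperHalfPlane.im UpperHalfPlane.atImInfty atTop := tendsto_comap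
    filter_upwards [him.eventually_ge_atTop 1] with z hz n
    rw [norm_mul, norm_mul, norm_qPow, norm_qPow]
    have h0 : (0 : ℝ) ≤ ((n : ℚ) / N : ℚ) := by
      have : (0 : ℚ) ≤ (n : ℚ) / N := by positivity
      exact_mod_cast this
    have hpi := Real.pi_pos
    gcongr
    simpa using hz

/-- Leading coefficients scale with the function; in particular they are unique. -/
lemma HasLeadingCoeff.eq_mul {f : ℍ → ℂ} {c c' β : ℂ} (h : HasLeadingCoeff f c)
    (h' : HasLeadingCoeff (fun z => β * f z) c') : c' = β * c := by
  obtain ⟨r, hr⟩ := h.exists_tendsto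
  obtain ⟨r', hr'⟩ := h'.exists_tendsto
  have hc : c ≠ 0 := h.1
  have hc' : c' ≠ 0 := h'.1
  have h1 := hr.const_mul β
  have hβ : β ≠ 0 := by
    rintro rfl
    simp only [zero_mul, mul_zero] at hr'
    exact hc' (tendsto_nhds_unique tendsto_const_nhds hr').symm
  have hβc : β * c ≠ 0 := mul_ne_zero hβ hc
  have h2 : Tendsto (qPow (r - r')) UpperHalfPlane.atImInfty (𝓝 (c' / (β * c))) := by
    refine (hr'.div h1 hβc).congr' ?_
    filter_upwards [h1.eventually_ne hβc] with z hz
    rw [Pi.div_apply, div_eq_iff hz, show -r' = (r - r') + -r by ring, qPow_add]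
    ring
  have h3 : r = r' := sub_eq_zero.mp (eq_zero_of_tendsto_qPow (div_ne_zero hc' hβc) h2)
  subst h3
  exact tendsto_nhds_unique hr' (h1.congr fun z => by ring)

lemma hasLeadingCoeff_qPow_mul {G : ℂ → ℂ} (hG : DifferentiableOn ℂ G (Metric.ball 0 1))
    (hG0 : G 0 ≠ 0) (r : ℚ) :
    HasLeadingCoeff (fun z => qPow r z * G (Complex.exp (2 * Real.pi * Complex.I * z))) (G 0) := by
  refine ⟨hG0, r, 1, fun n => (n.factorial : ℂ)⁻¹ * iteratedDeriv n G 0, one_pos, by simp,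
    fun z => ?_⟩
  have hq : Complex.exp (2 * Real.pi * Complex.I * z) ∈ Metric.ball (0 : ℂ) 1 := by
    simpa using norm_exp_lt_one z
  refine ((Complex.hasSum_taylorSeries_on_ball hG hq).mul_left (qPow r z)).congr_fun fun n => ?_
  rw [Nat.cast_one, div_one, qPow_add, qPow_natCast]
  simp only [sub_zero, smul_eq_mul]
  ring

/-! ### The Wronskian as a power of `η` -/

/-- The Wronskian of the characters is a nonzero multiple of `η^{2k(k-1)}`. -/
theorem exists_wronskian_character_eq_eta_pow (k : ℕ) : ∃ L : ℂ, L ≠ 0 ∧ ∀ z : ℍ,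
    wronskian (fun i : Fin k => character ((i : ℕ) + 1) k) z =
      L * ModularForm.eta z ^ (2 * k * (k - 1)) := by
  obtain ⟨H, hH, hH0, hW⟩ := exists_wronskian_character_eq k
  set W := wronskian (fun i : Fin k => character ((i : ℕ) + 1) k) with hWdef
  set E : ℂ → ℂ := fun q => ∏' n : ℕ, (1 - q ^ (n + 1)) with hE
  set m := 2 * k * (k - 1) with hm
  have hη (z : ℍ) := ModularForm.eta_ne_zero z.2
  have hE0 : E 0 = 1 := by simp [hE]
  have hEd : DifferentiableOn ℂ E (Metric.ball 0 1) := ModularForm.differentiableOn_tprod_one_sub_pow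
  have hF (z : ℍ) : W z / ModularForm.eta z ^ m =
      H (Complex.exp (2 * Real.pi * Complex.I * z)) /
        E (Complex.exp (2 * Real.pi * Complex.I * z)) ^ m := by
    have hq : qPow ((k * (k - 1) : ℚ) / 12) z ≠ 0 := Complex.exp_ne_zero _
    rw [hW, hm, eta_pow_eq, mul_div_mul_left _ _ hq]
  obtain ⟨M, hM⟩ := exists_character_S_smul k
  have hWS (z : ℍ) : W (ModularGroup.S • z) =
      (Matrix.of M).det * ((z : ℂ) ^ (k * (k - 1)) * W z) := by
    have h1 := wronskian_comp_S_smul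
      (f := fun i : Fin k => character ((i : ℕ) + 1) k) (fun i => mdifferentiable_character _ _) z
    simp_rw [hM] at h1
    rw [wronskian_linear_combination (fun i => mdifferentiable_character _ _)] at h1
    have hz : (z : ℂ) ^ (k * (k - 1)) ≠ 0 := pow_ne_zero _ z.ne_zero
    rw [eq_inv_mul_iff_mul_eq₀ hz] at h1
    rw [hWdef, ← h1]
    ring
  have hsqrt (w : ℂ) : Complex.sqrt w ^ 2 = w := by
    rw [Complex.sqrt, ← Complex.cpow_nat_mul]
    norm_num
  have hηS (z : ℍ) : ModularForm.eta ((ModularGroup.S • z : ℍ) : ℂ) ^ m =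
      (Complex.I⁻¹) ^ (k * (k - 1)) * ((z : ℂ) ^ (k * (k - 1)) * ModularForm.eta z ^ m) := by
    have hS : ((ModularGroup.S • z : ℍ) : ℂ) = -1 / z := by
      rw [UpperHalfPlane.modular_S_smul]
      simp [neg_div]
    have h1 : ModularForm.eta (-1 / z) =
        (Complex.sqrt Complex.I)⁻¹ * (Complex.sqrt z * ModularForm.eta z) :=
      ModularForm.eta_comp_eq_csqrt_I_inv z.2
    have hm2 : m = 2 * (k * (k - 1)) := by rw [hm, mul_assoc]
    rw [hS, h1, mul_pow, mul_pow]
    congr 1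
    · rw [hm2, pow_mul, inv_pow, hsqrt]
    · rw [hm2, pow_mul, hsqrt]
  have hmd : MDiff fun z : ℍ => W z / ModularForm.eta z ^ m := by
    have h0 : DifferentiableOn ℂ (fun q => H q / E q ^ m) (Metric.ball 0 1) :=
      hH.div (hEd.fun_pow m) fun q hq =>
        pow_ne_zero m (tprod_one_sub_pow_ne_zero (by simpa using hq))
    have h1 := mdifferentiable_qPow_mul h0 0
    simp_rw [← hF] at h1
    simpa [qPow] using h1
  have hconst := eq_const_of_quasi_invariant (f := fun z : ℍ => W z / ModularForm.eta z ^ m) hmd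
    (fun z => ?_) (ε := (Matrix.of M).det / (Complex.I⁻¹) ^ (k * (k - 1))) (fun z => ?_)
    (L := H 0) hH0 ?_
  · refine ⟨H 0, hH0, fun z => ?_⟩
    rw [← hconst z, div_mul_cancel₀ _ (pow_ne_zero _ (hη z))]
  · simp only [hF]
    have : Complex.exp (2 * Real.pi * Complex.I * ((ModularGroup.T • z : ℍ) : ℂ)) =
        Complex.exp (2 * Real.pi * Complex.I * z) := by
      rw [UpperHalfPlane.modular_T_smul, UpperHalfPlane.coe_vadd, mul_add, Complex.ofReal_one,
        mul_one, Complex.exp_add, Complex.exp_two_pi_mul_I, one_mul]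
    rw [this]
  · rw [hWS, hηS, mul_div_mul_comm, mul_div_mul_left _ _ (pow_ne_zero _ z.ne_zero)]
  · simp_rw [hF]
    have hcont {G : ℂ → ℂ} (hG : DifferentiableOn ℂ G (Metric.ball 0 1)) :
        Tendsto (fun z : ℍ => G (Complex.exp (2 * Real.pi * Complex.I * z)))
          UpperHalfPlane.atImInfty (𝓝 (G 0)) :=
      (hG.continuousOn.continuousAt (Metric.ball_mem_nhds 0 one_pos)).tendsto.comp
        tendsto_exp_two_pi_I
    have := (hcont hH).div ((hcont hEd).pow m) (by rw [hE0]; simp)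
    simpa [hE0] using! this

end AndrewsGordon

theorem theorem1p1 (k : ℕ) (hk : 2 ≤ k) :
    (∃! α : ℂ, AndrewsGordon.HasLeadingCoeff (fun z : UpperHalfPlane =>
      α * AndrewsGordon.wronskian
        (fun i : Fin k => AndrewsGordon.character ((i : ℕ) + 1) k) z) 1) ∧
    ∀ α : ℂ, AndrewsGordon.HasLeadingCoeff (fun z : UpperHalfPlane =>
      α * AndrewsGordon.wronskian
        (fun i : Fin k => AndrewsGordon.character ((i : ℕ) + 1) k) z) 1 →
      ∀ z : UpperHalfPlane,
        α * AndrewsGordon.wronskian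
          (fun i : Fin k => AndrewsGordon.character ((i : ℕ) + 1) k) z =
        ModularForm.eta (z : ℂ) ^ (2 * k * (k - 1)) := by
  obtain ⟨L, hL0, hL⟩ := AndrewsGordon.exists_wronskian_character_eq_eta_pow k
  have hη : AndrewsGordon.HasLeadingCoeff
      (fun z : UpperHalfPlane => ModularForm.eta (z : ℂ) ^ (2 * k * (k - 1))) 1 := by
    simp_rw [AndrewsGordon.eta_pow_eq]
    have h := AndrewsGordon.hasLeadingCoeff_qPow_mul
      (G := fun q => (∏' n : ℕ, (1 - q ^ (n + 1))) ^ (2 * k * (k - 1)))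
      (ModularForm.differentiableOn_tprod_one_sub_pow.fun_pow _) (by simp)
      ((k * (k - 1) : ℚ) / 12)
    simpa using h
  have huniq (α : ℂ) (hα : AndrewsGordon.HasLeadingCoeff (fun z : UpperHalfPlane =>
      α * AndrewsGordon.wronskian
        (fun i : Fin k => AndrewsGordon.character ((i : ℕ) + 1) k) z) 1) : α = L⁻¹ := by
    simp_rw [hL, ← mul_assoc] at hα
    have h := hη.eq_mul hα
    rw [mul_one] at h
    exact eq_inv_of_mul_eq_one_left h.symm
  refine ⟨⟨L⁻¹, ?_, huniq⟩, fun α hα z => ?_⟩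
  · simpa only [hL, inv_mul_cancel_left₀ hL0] using hη
  · rw [huniq α hα, hL, inv_mul_cancel_left₀ hL0]
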